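/- Let $k$ be a field and let $A$ be a Frobenius $k$-algebra, i.e. a finite-dimensional associative unital $k$-algebra that has a nonsingular associative $k$-bilinear form $\beta\colon A\times A\to k$ (associative: $\beta(ab,c)=\beta(a,bc)$). Assume that $k$ is a splitting field for $A$, i.e. $\operatorname{End}_A(V)=k$ for every irreducible left $A$-module $V$. Fix any such form $\beta$, and let $x_1,\dots,x_n$ and $y_1,\dots,y_n$ be dual bases for $\beta$, i.e. elements of $A$ with $a=\sum_i\beta(a,y_i)x_i$ for all $a\in A$. The Higman trace is the $k$-linear map $\tau\colon A\to A$, $\tau(a)=\sum_i x_i a y_i$; it depends only on $\beta$, not on the dual bases. For a $k$-algebra $R$ put $T(R)=R/[R,R]$, where $[R,R]$ is spanned by all $xy-yx$ with $x,y\in R$. The map $\tau$ factors through the canonical map $A\twoheadrightarrow T(A/\operatorname{rad}A)$, where $\operatorname{rad}A$ is the Jacobson radical; let $\tilde\tau\colon T(A/\operatorname{rad}A)\to A$ be the induced map. Let $K_0(A)$ and $G_0(A)$ be the Grothendieck groups of the finitely generated projective left $A$-modules and of all finitely generated left $A$-modules, respectively (with a relation $[V]=[U]+[W]$ for each short exact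 sequence $0\to U\to V\to W\to 0$), and let $c\colon K_0(A)\to G_0(A)$, $[P]\mapsto[P]$, be the Cartan map. Let $V_1,\dots,V_r$ represent the isomorphism classes of irreducible left $A$-modules, and let $P_j$ be a projective cover of $V_j$. The Cartan matrix $C\in M_r(\mathbb Z)$ is the matrix of $c$ with respect to the $\mathbb Z$-bases $[P_1],\dots,[P_r]$ of $K_0(A)$ and $[V_1],\dots,[V_r]$ of $G_0(A)$. Then: (a) The rank of the $k$-linear map $c\otimes 1_k\colon K_0(A)\otimes_{\mathbb Z}k\to G_0(A)\otimes_{\mathbb Z}k$ equals the rank of $\tau$. (b) If $A\neq 0$, then the following are equivalent: (i) $A$ is semisimple; (ii) $C=\operatorname{Id}$ and $\tilde\tau^{-1}(A^\times\cup\{0\})\neq\{0\}$; (iii) $\operatorname{char}k$ does not divide $\det C$ (for $\operatorname{char}k=0$: $\det C\neq 0$) and $\tilde\tau^{-1}(A^\times\cup\{0\})\neq\{0\}$. -/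

import Mathlib

universe u v w

namespace FrobeniusCartan

section Trace

variable (k : Type v) (R : Type u) [Field k] [Ring R] [Algebra k R]

/-- `[R, R]`, spanned by all Lie commutators `x * y - y * x`. -/
def commutatorSubmodule : Submodule k R :=
  Submodule.span k {z | ∃ x y : R, z = x * y - y * x}

/-- `T(R) = R / [R, R]`. -/
abbrev TraceSpace : Type u := R ⧸ commutatorSubmodule k R

variable {R} in
/-- The canonical map `R → T(R)`. -/
abbrev traceClass : R →ₗ[k] TraceSpace k R := (commutatorSubmodule k R).mkQ

end Trace

section Frobenius

variable (k : Type v) (A : Type u) [Field k] [Ring A] [Algebra k A]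

/-- A nonsingular associative `k`-bilinear form `β : A × A → k`. A finite-dimensional `k`-algebra
is Frobenius if and only if it has such a form. -/
structure FrobeniusForm where
  form : LinearMap.BilinForm k A
  assoc : ∀ a b c : A, form (a * b) c = form a (b * c)
  nondegenerate : form.Nondegenerate

variable {k A} [Module.Finite k A]

namespace FrobeniusForm

variable (β : FrobeniusForm k A)

/-- The second family `y` of a pair of dual bases for `β`. -/
noncomputable def dualY (i : Fin (Module.finrank k A)) : A := Module.finBasis k A i

/-- The first family `x` of a pair of dual bases for `β`, so that `β (x i) (y j) = δ i j`. -/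
noncomputable def dualX : Fin (Module.finrank k A) → A :=
  β.form.dualBasis β.nondegenerate (Module.finBasis k A)

/-- The dual basis identity `a = ∑ i, β(a, y i) x i`. -/
theorem sum_dual (a : A) : ∑ i, β.form a (dualY (k := k) i) • β.dualX i = a := by
  have := (β.form.dualBasis β.nondegenerate (Module.finBasis k A)).sum_repr a
  simpa [dualX, dualY] using this

/-- The Higman trace `τ(a) = ∑ i, x i * a * y i` of `β`. -/
noncomputable def higmanTrace : A →ₗ[k] A :=
  ∑ i, LinearMap.mulLeft k (β.dualX i) ∘ₗ LinearMap.mulRight k (dualY (k := k) i)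

theorem higmanTrace_apply (a : A) :
    β.higmanTrace a = ∑ i, β.dualX i * a * dualY (k := k) i := by
  simp [higmanTrace, mul_assoc]

/-- Trace formula for arbitrary dual bases `x`, `y`. -/
theorem form_mul_eq_trace {ι : Type*} [Fintype ι] (x y : ι → A)
    (h : ∀ a, ∑ i, β.form a (y i) • x i = a) (a b : A) :
    β.form b (∑ i, x i * a * y i) =
      LinearMap.trace k A (LinearMap.mulLeft k b * LinearMap.mulRight k a) := by
  have key : LinearMap.mulLeft k b * LinearMap.mulRight k a =
      dualTensorHom k A A (∑ i, (β.form.flip (y i)) ⊗ₜ[k] (b * x i * a)) := by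
    ext z
    conv_lhs => rw [← h z]
    simp [mul_assoc]
  rw [key, LinearMap.trace_eq_contract_apply]
  simp [← β.assoc, mul_assoc]

/-- The Higman trace can be computed with arbitrary dual bases. -/
theorem higmanTrace_eq {ι : Type*} [Fintype ι] (x y : ι → A)
    (h : ∀ a, ∑ i, β.form a (y i) • x i = a) (a : A) :
    β.higmanTrace a = ∑ i, x i * a * y i := by
  rw [← sub_eq_zero]
  refine β.nondegenerate.2 _ fun b => ?_
  rw [map_sub, higmanTrace_apply, β.form_mul_eq_trace _ _ β.sum_dual, β.form_mul_eq_trace x y h,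
    sub_self]

theorem form_higmanTrace (a b : A) : β.form b (β.higmanTrace a) =
    LinearMap.trace k A (LinearMap.mulLeft k b * LinearMap.mulRight k a) := by
  rw [higmanTrace_apply, β.form_mul_eq_trace _ _ β.sum_dual]

theorem higmanTrace_commutator (x y : A) : β.higmanTrace (x * y - y * x) = 0 := by
  refine β.nondegenerate.2 _ fun b => ?_
  have h1 : LinearMap.mulLeft k b * LinearMap.mulRight k (x * y) =
      LinearMap.mulRight k y * (LinearMap.mulLeft k b * LinearMap.mulRight k x) := by
    ext z; simp [mul_assoc]
  have h2 : LinearMap.mulLeft k b * LinearMap.mulRight k (y * x) =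
      (LinearMap.mulLeft k b * LinearMap.mulRight k x) * LinearMap.mulRight k y := by
    ext z; simp [mul_assoc]
  rw [map_sub, map_sub, form_higmanTrace, form_higmanTrace, h1, h2, LinearMap.trace_mul_comm,
    sub_self]

theorem higmanTrace_jacobson {a : A} (ha : a ∈ Ring.jacobson A) : β.higmanTrace a = 0 := by
  have : IsArtinianRing A := IsArtinianRing.of_finite k A
  obtain ⟨n, hn⟩ := (inferInstance : IsSemiprimaryRing A).isNilpotent
  have han : a ^ n = 0 := by
    have := Ideal.pow_mem_pow ha n
    rwa [hn] at this
  refine β.nondegenerate.2 _ fun b => ?_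
  rw [form_higmanTrace]
  have hnil : IsNilpotent (LinearMap.mulLeft k b * LinearMap.mulRight k a) := by
    refine Commute.isNilpotent_mul_left ?_ ⟨n, ?_⟩
    · ext z; simp [mul_assoc]
    · rw [LinearMap.pow_mulRight, han, LinearMap.mulRight_zero_eq_zero]
  exact (LinearMap.isNilpotent_trace_of_isNilpotent hnil).eq_zero

/-- The canonical map `A → T(A / rad A)`. -/
noncomputable def can : A →ₗ[k] TraceSpace k (A ⧸ Ring.jacobson A) :=
  traceClass k ∘ₗ (Ideal.Quotient.mkₐ k (Ring.jacobson A)).toLinearMap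

/-- The map `A / rad A → A` induced by the Higman trace. -/
noncomputable def higmanTraceRad : (A ⧸ Ring.jacobson A) →ₗ[k] A :=
  ((Ring.jacobson A).restrictScalars k).liftQ β.higmanTrace
      (fun _ ha => LinearMap.mem_ker.2 (β.higmanTrace_jacobson ha)) ∘ₗ
    (Submodule.Quotient.restrictScalarsEquiv k (Ring.jacobson A)).symm.toLinearMap

/-- The map `τ̃ : T(A / rad A) → A` induced by the Higman trace. -/
noncomputable def higmanTraceTilde : TraceSpace k (A ⧸ Ring.jacobson A) →ₗ[k] A :=
  (commutatorSubmodule k (A ⧸ Ring.jacobson A)).liftQ β.higmanTraceRad <| by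
    rw [commutatorSubmodule, Submodule.span_le]
    rintro _ ⟨x, y, rfl⟩
    obtain ⟨x, rfl⟩ := Ideal.Quotient.mk_surjective x
    obtain ⟨y, rfl⟩ := Ideal.Quotient.mk_surjective y
    exact β.higmanTrace_commutator x y

/-- `τ = τ̃ ∘ can`. -/
theorem higmanTraceTilde_can (a : A) : β.higmanTraceTilde (can a) = β.higmanTrace a := rfl

end FrobeniusForm

end Frobenius

section Grothendieck

variable {A : Type u} [Ring A]

/-- Relations of the Grothendieck group of a class `C` of `A`-modules: `[V] = [U] + [W]` for every
exact sequence `0 → U → V → W → 0` of modules in `C`. -/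
def grothendieckRelations (C : ModuleCat.{u} A → Prop) :
    Set (FreeAbelianGroup {M : ModuleCat.{u} A // C M}) :=
  {x | ∃ (U V W : {M : ModuleCat.{u} A // C M}) (f : U.1 →ₗ[A] V.1) (g : V.1 →ₗ[A] W.1),
    Function.Injective f ∧ Function.Exact f g ∧ Function.Surjective g ∧
      x = FreeAbelianGroup.of V - (FreeAbelianGroup.of U + FreeAbelianGroup.of W)}

/-- The Grothendieck group of a class of `A`-modules. -/
abbrev Grothendieck (C : ModuleCat.{u} A → Prop) : Type (u + 1) :=
  FreeAbelianGroup {M : ModuleCat.{u} A // C M} ⧸ AddSubgroup.closure (grothendieckRelations C)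

namespace Grothendieck

variable {C D : ModuleCat.{u} A → Prop}

/-- The class `[M]`. -/
def cls (M : ModuleCat.{u} A) (h : C M) : Grothendieck C :=
  QuotientAddGroup.mk (FreeAbelianGroup.of ⟨M, h⟩)

theorem cls_eq_add {U V W : ModuleCat.{u} A} (hU : C U) (hV : C V) (hW : C W)
    (f : U →ₗ[A] V) (g : V →ₗ[A] W) (hf : Function.Injective f) (hfg : Function.Exact f g)
    (hg : Function.Surjective g) : cls V hV = cls U hU + cls W hW := by
  rw [← sub_eq_zero]
  exact (QuotientAddGroup.eq_zero_iff _).2 (AddSubgroup.subset_closure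
    ⟨⟨U, hU⟩, ⟨V, hV⟩, ⟨W, hW⟩, f, g, hf, hfg, hg, rfl⟩)

/-- The homomorphism given by an additive function. -/
noncomputable def lift {G : Type w} [AddCommGroup G] (φ : {M : ModuleCat.{u} A // C M} → G)
    (h : ∀ (U V W : {M : ModuleCat.{u} A // C M}) (f : U.1 →ₗ[A] V.1) (g : V.1 →ₗ[A] W.1),
      Function.Injective f → Function.Exact f g → Function.Surjective g → φ V = φ U + φ W) :
    Grothendieck C →+ G :=
  QuotientAddGroup.lift _ (FreeAbelianGroup.lift φ) <| by
    rw [AddSubgroup.closure_le]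
    rintro _ ⟨U, V, W, f, g, hf, hfg, hg, rfl⟩
    simp [h U V W f g hf hfg hg]

@[simp]
theorem lift_cls {G : Type w} [AddCommGroup G] (φ : {M : ModuleCat.{u} A // C M} → G) (h)
    (M : ModuleCat.{u} A) (hM : C M) : lift φ h (cls M hM) = φ ⟨M, hM⟩ :=
  FreeAbelianGroup.lift_apply_of ..

/-- The homomorphism `[M] ↦ [M]` given by an inclusion of classes of modules. -/
noncomputable def map (h : ∀ M, C M → D M) : Grothendieck C →+ Grothendieck D :=
  lift (fun M => cls M.1 (h M.1 M.2)) fun _ _ _ f g hf hfg hg => cls_eq_add _ _ _ f g hf hfg hg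

theorem map_cls (h : ∀ M, C M → D M) (M : ModuleCat.{u} A) (hM : C M) :
    map h (cls M hM) = cls M (h M hM) := lift_cls ..

theorem closure_cls : AddSubgroup.closure {x : Grothendieck C | ∃ M h, x = cls M h} = ⊤ := by
  rw [eq_top_iff]
  rintro x -
  obtain ⟨x, rfl⟩ := QuotientAddGroup.mk_surjective x
  induction x using FreeAbelianGroup.induction_on with
  | zero => exact zero_mem _
  | of M => exact AddSubgroup.subset_closure ⟨M.1, M.2, rfl⟩
  | neg M h => exact neg_mem h
  | add x y hx hy => exact add_mem hx hy

end Grothendieck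

variable (A)

/-- `G₀(A)`, the Grothendieck group of all finitely generated `A`-modules. -/
abbrev G0 : Type (u + 1) := Grothendieck fun M : ModuleCat.{u} A => Module.Finite A M

/-- `K₀(A)`, the Grothendieck group of all finitely generated projective `A`-modules. -/
abbrev K0 : Type (u + 1) :=
  Grothendieck fun M : ModuleCat.{u} A => Module.Finite A M ∧ Module.Projective A M

/-- The Cartan map `c : K₀(A) → G₀(A)`, `[P] ↦ [P]`. -/
noncomputable def cartanMap : K0 A →ₗ[ℤ] G0 A :=
  (Grothendieck.map fun _ h => h.1).toIntLinearMap

end Grothendieck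

section Irreducible

variable (A : Type u) [Ring A]

/-- Isomorphism of simple modules `A / m`, `m` a maximal left ideal. -/
def maximalSetoid : Setoid {m : Ideal A // m.IsMaximal} where
  r m n := Nonempty ((A ⧸ m.1) ≃ₗ[A] (A ⧸ n.1))
  iseqv := ⟨fun _ => ⟨.refl A _⟩, fun ⟨e⟩ => ⟨e.symm⟩, fun ⟨e⟩ ⟨f⟩ => ⟨e.trans f⟩⟩

/-- The set of isomorphism classes of irreducible left `A`-modules. As each irreducible module is
isomorphic to `A / m` for some maximal left ideal `m`, these are the classes of the `A / m`. -/
def Irr : Type u := Quotient (maximalSetoid A)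

variable {A}

/-- A maximal left ideal `m` such that `A / m` belongs to the class `i`. -/
noncomputable def Irr.ideal (i : Irr A) : Ideal A := (Quotient.out i).1

instance (i : Irr A) : i.ideal.IsMaximal := (Quotient.out i).2

/-- An irreducible module in the class `i`. -/
abbrev Irr.V (i : Irr A) : Type u := A ⧸ i.ideal

instance (i : Irr A) : IsSimpleModule A i.V :=
  isSimpleModule_iff_isCoatom.2 (Ideal.isMaximal_def.1 inferInstance)

theorem Irr.eq_of_equiv {i j : Irr A} (e : i.V ≃ₗ[A] j.V) : i = j := by
  rw [← Quotient.out_eq i, ← Quotient.out_eq j]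
  exact Quotient.sound ⟨e⟩

theorem Irr.exists_equiv (M : Type u) [AddCommGroup M] [Module A M] [IsSimpleModule A M] :
    ∃ i : Irr A, Nonempty (M ≃ₗ[A] i.V) := by
  obtain ⟨m, hm, ⟨e⟩⟩ := isSimpleModule_iff_quot_maximal.1 (inferInstance : IsSimpleModule A M)
  obtain ⟨f⟩ := Quotient.exact (Quotient.out_eq (Quotient.mk (maximalSetoid A) ⟨m, hm⟩))
  exact ⟨Quotient.mk (maximalSetoid A) ⟨m, hm⟩, ⟨e.trans f.symm⟩⟩

/-- `π : P → V` is a projective cover: `P` is projective, and `π` is an epimorphism with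
superfluous kernel. -/
structure IsProjectiveCover {P V : Type u} [AddCommGroup P] [AddCommGroup V] [Module A P]
    [Module A V] (π : P →ₗ[A] V) : Prop where
  projective : Module.Projective A P
  surjective : Function.Surjective π
  superfluous : ∀ N : Submodule A P, N ⊔ LinearMap.ker π = ⊤ → N = ⊤

theorem IsProjectiveCover.surjective_of_comp {P V M : Type u} [AddCommGroup P] [AddCommGroup V]
    [AddCommGroup M] [Module A P] [Module A V] [Module A M] {π : P →ₗ[A] V}
    (h : IsProjectiveCover π) (f : M →ₗ[A] P) (hf : Function.Surjective (π ∘ₗ f)) :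
    Function.Surjective f := by
  rw [← LinearMap.range_eq_top]
  refine h.superfluous _ (eq_top_iff.2 fun x _ => ?_)
  obtain ⟨m, hm⟩ := hf (π x)
  refine Submodule.mem_sup.2 ⟨f m, ⟨m, rfl⟩, x - f m, ?_, by abel⟩
  simpa [sub_eq_zero] using hm.symm

theorem exists_isProjectiveCover [IsArtinianRing A] (i : Irr A) :
    ∃ (L : Ideal A) (π : L →ₗ[A] i.V), IsProjectiveCover π := by
  let S : Set (Ideal A) := {L | L ⊔ i.ideal = ⊤}
  obtain ⟨L, hL, hmin⟩ := wellFounded_lt.has_min S ⟨⊤, by simp [S]⟩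
  let q : A →ₗ[A] i.V := i.ideal.mkQ
  let π : L →ₗ[A] i.V := q ∘ₗ L.subtype
  have hq : Function.Surjective q := Submodule.mkQ_surjective _
  have hπ : Function.Surjective π := by
    intro x
    obtain ⟨a, rfl⟩ := hq x
    have : a ∈ L ⊔ i.ideal := by rw [show L ⊔ i.ideal = ⊤ from hL]; trivial
    obtain ⟨l, hl, m, hm, rfl⟩ := Submodule.mem_sup.1 this
    refine ⟨⟨l, hl⟩, ?_⟩
    simpa [π, q, Submodule.Quotient.eq] using hm
  have hsup : ∀ N : Submodule A L, N ⊔ LinearMap.ker π = ⊤ → N = ⊤ := by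
    intro N hN
    have hNS : N.map L.subtype ∈ S := by
      refine eq_top_iff.2 fun a _ => ?_
      have : a ∈ L ⊔ i.ideal := by rw [show L ⊔ i.ideal = ⊤ from hL]; trivial
      obtain ⟨l, hl, m, hm, rfl⟩ := Submodule.mem_sup.1 this
      have : (⟨l, hl⟩ : L) ∈ N ⊔ LinearMap.ker π := by rw [hN]; trivial
      obtain ⟨x, hx, y, hy, hxy⟩ := Submodule.mem_sup.1 this
      have hy' : (y : A) ∈ i.ideal := by simpa [π, q] using hy
      have : l = x + y := by simpa using congrArg Subtype.val hxy.symm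
      exact Submodule.mem_sup.2
        ⟨x, ⟨x, hx, rfl⟩, y + m, add_mem hy' hm, by rw [this]; abel⟩
    have hle : N.map L.subtype ≤ L := Submodule.map_subtype_le _ _
    have heq : N.map L.subtype = L := by
      by_contra hne
      exact hmin _ hNS (lt_of_le_of_ne hle hne)
    rw [eq_top_iff]
    rintro ⟨l, hl⟩ -
    rw [← heq] at hl
    obtain ⟨x, hx, hxl⟩ := hl
    have : x = ⟨l, by rw [← heq]; exact ⟨x, hx, hxl⟩⟩ := Subtype.ext hxl
    rwa [← this]
  obtain ⟨h, hh⟩ := Module.projective_lifting_property π q hπ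
  have hsurj : Function.Surjective (h ∘ₗ L.subtype) := by
    rw [← LinearMap.range_eq_top]
    refine hsup _ (eq_top_iff.2 fun x _ => ?_)
    refine Submodule.mem_sup.2 ⟨h x, ⟨x, rfl⟩, x - h x, ?_, by abel⟩
    have : π (h x) = q x := LinearMap.congr_fun hh x
    rw [LinearMap.mem_ker, map_sub, this]
    exact sub_self _
  have hinj := IsNoetherian.injective_of_surjective_endomorphism _ hsurj
  let e := LinearEquiv.ofBijective _ ⟨hinj, hsurj⟩
  refine ⟨L, π, Module.Projective.of_split L.subtype (e.symm.toLinearMap ∘ₗ h) ?_, hπ, hsup⟩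
  exact LinearMap.ext fun x => e.symm_apply_apply x

variable [IsArtinianRing A]

/-- A projective cover `P → V` of the irreducible module `V` in the class `i`. -/
noncomputable def Irr.P (i : Irr A) : Ideal A := (exists_isProjectiveCover i).choose

/-- The covering map. -/
noncomputable def Irr.π (i : Irr A) : i.P →ₗ[A] i.V := (exists_isProjectiveCover i).choose_spec.choose

theorem Irr.isProjectiveCover (i : Irr A) : IsProjectiveCover i.π :=
  (exists_isProjectiveCover i).choose_spec.choose_spec

instance (i : Irr A) : Module.Projective A i.P := i.isProjectiveCover.projective

theorem Irr.eq_of_ne_zero {i j : Irr A} (f : i.P →ₗ[A] j.V) (hf : f ≠ 0) : i = j := by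
  have hs : Function.Surjective f := LinearMap.surjective_of_ne_zero hf
  have h1 : IsCoatom (LinearMap.ker f) :=
    isSimpleModule_iff_isCoatom.1 (.congr (f.quotKerEquivOfSurjective hs))
  have h2 : IsCoatom (LinearMap.ker i.π) :=
    isSimpleModule_iff_isCoatom.1 (.congr (i.π.quotKerEquivOfSurjective i.isProjectiveCover.surjective))
  have h3 : LinearMap.ker f = LinearMap.ker i.π := by
    by_contra hne
    exact h1.1 (i.isProjectiveCover.superfluous _ (h1.sup_eq_top_of_ne h2 hne))
  exact Irr.eq_of_equiv (((i.π.quotKerEquivOfSurjective i.isProjectiveCover.surjective).symm.trans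
    (Submodule.quotEquivOfEq _ _ h3.symm)).trans (f.quotKerEquivOfSurjective hs))

theorem Irr.π_ne_zero (i : Irr A) : i.π ≠ 0 := by
  intro h
  have := IsSimpleModule.nontrivial A i.V
  obtain ⟨x, hx⟩ := exists_ne (0 : i.V)
  obtain ⟨y, rfl⟩ := i.isProjectiveCover.surjective x
  exact hx (by rw [h]; rfl)

theorem Irr.nontrivial_P (i : Irr A) : Nontrivial i.P := by
  rw [← not_subsingleton_iff_nontrivial]
  exact fun _ => i.π_ne_zero (Subsingleton.elim _ _)

end Irreducible


section Bases

open scoped ModuleCat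

variable (k : Type v) {A : Type u} [Field k] [Ring A] [Algebra k A]

theorem finrank_of_exact {X Y Z : Type*} [AddCommGroup X] [AddCommGroup Y] [AddCommGroup Z]
    [Module k X] [Module k Y] [Module k Z] [Module.Finite k Y] (f : X →ₗ[k] Y) (g : Y →ₗ[k] Z)
    (hf : Function.Injective f) (hfg : Function.Exact f g) (hg : Function.Surjective g) :
    Module.finrank k Y = Module.finrank k X + Module.finrank k Z := by
  rw [← g.finrank_range_add_finrank_ker, LinearMap.range_eq_top.2 hg, finrank_top,
    hfg.linearMap_ker_eq, LinearMap.finrank_range_of_inj hf, add_comm]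

section Hom

variable {P M U V W : Type u} [AddCommGroup P] [AddCommGroup M] [AddCommGroup U] [AddCommGroup V]
  [AddCommGroup W] [Module A P] [Module A M] [Module A U] [Module A V] [Module A W]
  [Module k P] [Module k M] [Module k V]
  [IsScalarTower k A P] [IsScalarTower k A M] [IsScalarTower k A V]

theorem finite_hom [Module.Finite k P] [Module.Finite k M] : Module.Finite k (P →ₗ[A] M) :=
  Module.Finite.of_injective (LinearMap.restrictScalarsₗ k A P M k)
    (LinearMap.restrictScalars_injective k)

theorem finrank_hom_of_exact [Module k U] [Module k W] [IsScalarTower k A U]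
    [IsScalarTower k A W] [Module.Finite k P] [Module.Finite k V] [Module.Projective A P]
    (f : U →ₗ[A] V) (g : V →ₗ[A] W)
    (hf : Function.Injective f) (hfg : Function.Exact f g) (hg : Function.Surjective g) :
    Module.finrank k (P →ₗ[A] V) = Module.finrank k (P →ₗ[A] U) + Module.finrank k (P →ₗ[A] W) := by
  have := finite_hom k (A := A) (P := P) (M := V)
  let F : (P →ₗ[A] U) →ₗ[k] (P →ₗ[A] V) :=
    { toFun := fun φ => f ∘ₗ φ
      map_add' := fun _ _ => LinearMap.comp_add ..
      map_smul' := fun c φ => by ext x; exact f.map_smul_of_tower c (φ x) }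
  let G : (P →ₗ[A] V) →ₗ[k] (P →ₗ[A] W) :=
    { toFun := fun φ => g ∘ₗ φ
      map_add' := fun _ _ => LinearMap.comp_add ..
      map_smul' := fun c φ => by ext x; exact g.map_smul_of_tower c (φ x) }
  refine finrank_of_exact k F G (fun a b h => ?_) (fun φ => ⟨fun h => ?_, ?_⟩) fun φ => ?_
  · ext x; exact hf (LinearMap.congr_fun h x)
  · let e := LinearEquiv.ofInjective f hf
    have hr : ∀ x, φ x ∈ LinearMap.range f := fun x => (hfg _).1 (LinearMap.congr_fun h x)
    refine ⟨e.symm.toLinearMap ∘ₗ φ.codRestrict _ hr, ?_⟩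
    ext x
    exact congrArg Subtype.val (e.apply_symm_apply ⟨φ x, hr x⟩)
  · rintro ⟨ψ, rfl⟩
    ext x
    exact hfg.apply_apply_eq_zero (ψ x)
  · exact Module.projective_lifting_property g φ hg

theorem finrank_hom_of_exact' [Module.Finite k M] [Module.Finite k V] [Module.Projective A W]
    (f : U →ₗ[A] V) (g : V →ₗ[A] W)
    (hf : Function.Injective f) (hfg : Function.Exact f g) (hg : Function.Surjective g) :
    Module.finrank k (V →ₗ[A] M) = Module.finrank k (U →ₗ[A] M) + Module.finrank k (W →ₗ[A] M) := by
  have := finite_hom k (A := A) (P := V) (M := M)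
  let F : (V →ₗ[A] M) →ₗ[k] (U →ₗ[A] M) :=
    { toFun := fun φ => φ ∘ₗ f
      map_add' := fun _ _ => LinearMap.add_comp ..
      map_smul' := fun c φ => rfl }
  let G : (W →ₗ[A] M) →ₗ[k] (V →ₗ[A] M) :=
    { toFun := fun φ => φ ∘ₗ g
      map_add' := fun _ _ => LinearMap.add_comp ..
      map_smul' := fun c φ => rfl }
  rw [add_comm]
  obtain ⟨s, hs⟩ := Module.projective_lifting_property g LinearMap.id hg
  have hs' : ∀ w, g (s w) = w := LinearMap.congr_fun hs
  let e := LinearEquiv.ofInjective f hf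
  have hr : ∀ x, (LinearMap.id - s ∘ₗ g : V →ₗ[A] V) x ∈ LinearMap.range f := fun x =>
    (hfg _).1 (by simp [hs'])
  let r : V →ₗ[A] U := e.symm.toLinearMap ∘ₗ (LinearMap.id - s ∘ₗ g : V →ₗ[A] V).codRestrict _ hr
  have hfr : ∀ x, f (r x) = x - s (g x) := fun x =>
    congrArg Subtype.val (e.apply_symm_apply ⟨_, hr x⟩)
  refine finrank_of_exact k G F (fun a b h => ?_) (fun φ => ⟨fun h => ?_, ?_⟩) fun φ => ?_
  · ext x
    obtain ⟨y, rfl⟩ := hg x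
    exact LinearMap.congr_fun h y
  · refine ⟨φ ∘ₗ s, ?_⟩
    ext x
    have : φ (f (r x)) = 0 := LinearMap.congr_fun h (r x)
    rw [hfr, map_sub, sub_eq_zero] at this
    exact this.symm
  · rintro ⟨ψ, rfl⟩
    ext x
    change ψ (g (f x)) = 0
    rw [hfg.apply_apply_eq_zero, map_zero]
  · refine ⟨φ ∘ₗ r, ?_⟩
    ext x
    change φ (r (f x)) = φ x
    congr 1
    apply hf
    rw [hfr, hfg.apply_apply_eq_zero, map_zero, sub_zero]

end Hom

theorem linearIndependent_of_pairing {ι : Type*} {N : Type*} [AddCommGroup N] (x : ι → N)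
    (h : ι → N →+ ℤ) (h0 : ∀ i j, i ≠ j → h i (x j) = 0) (h1 : ∀ i, h i (x i) ≠ 0) :
    LinearIndependent ℤ x := by
  rw [linearIndependent_iff']
  intro s g hg i hi
  have := congrArg (h i) hg
  rw [map_sum, Finset.sum_eq_single i] at this
  · simpa [h1 i] using this
  · intro j _ hj
    simp [h0 i j hj.symm]
  · exact fun h => absurd hi h

variable [Module.Finite k A]

theorem finite_restrict (M : ModuleCat.{u} A) [Module.Finite A M] : Module.Finite k M :=
  Module.Finite.trans A M

variable [IsArtinianRing A]

/-- `[V]` for the irreducible module `V` in the class `i`. -/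
noncomputable def irrClass (i : Irr A) : G0 A :=
  Grothendieck.cls (.of A i.V) (inferInstanceAs (Module.Finite A i.V))

/-- `[P]` for the projective cover `P` of the irreducible module in the class `i`. -/
noncomputable def projClass (i : Irr A) : K0 A :=
  Grothendieck.cls (.of A i.P)
    ⟨inferInstanceAs (Module.Finite A i.P), inferInstanceAs (Module.Projective A i.P)⟩

/-- `[M] ↦ dim Hom(P, M)`. -/
noncomputable def homFromP (i : Irr A) : G0 A →+ ℤ :=
  Grothendieck.lift (fun M => (Module.finrank k (i.P →ₗ[A] M.1) : ℤ)) <| by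
    rintro ⟨U, hU⟩ ⟨V, hV⟩ ⟨W, hW⟩ f g hf hfg hg
    have := finite_restrict k V
    exact_mod_cast finrank_hom_of_exact k f g hf hfg hg

/-- `[P] ↦ dim Hom(P, V)`. -/
noncomputable def homToV (i : Irr A) : K0 A →+ ℤ :=
  Grothendieck.lift (fun M => (Module.finrank k (M.1 →ₗ[A] i.V) : ℤ)) <| by
    rintro ⟨U, hU⟩ ⟨V, hV⟩ ⟨W, hW⟩ f g hf hfg hg
    have := hV.1
    have := hW.2
    have := finite_restrict k V
    exact_mod_cast finrank_hom_of_exact' k f g hf hfg hg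


theorem homFromP_cls_eq_zero (i : Irr A) (M : ModuleCat.{u} A) (hM : Module.Finite A M)
    (h : Subsingleton (i.P →ₗ[A] M)) : homFromP k i (Grothendieck.cls M hM) = 0 := by
  rw [homFromP, Grothendieck.lift_cls]
  exact_mod_cast Module.finrank_zero_of_subsingleton

theorem homFromP_cls_ne_zero (i : Irr A) (M : ModuleCat.{u} A) (hM : Module.Finite A M)
    (h : Nontrivial (i.P →ₗ[A] M)) : homFromP k i (Grothendieck.cls M hM) ≠ 0 := by
  rw [homFromP, Grothendieck.lift_cls]
  have := finite_restrict k M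
  have := finite_hom k (A := A) (P := i.P) (M := M)
  exact_mod_cast (Module.finrank_pos (R := k) (M := i.P →ₗ[A] M)).ne'

theorem homFromP_irrClass_of_ne {i j : Irr A} (h : i ≠ j) : homFromP k i (irrClass j) = 0 := by
  have : ∀ f : i.P →ₗ[A] j.V, f = 0 := fun f => by
    by_contra hf
    exact h (Irr.eq_of_ne_zero f hf)
  exact homFromP_cls_eq_zero k i _ _ ⟨fun f g => by rw [this f, this g]⟩

theorem homFromP_irrClass_self (i : Irr A) : homFromP k i (irrClass i) ≠ 0 :=
  homFromP_cls_ne_zero k i _ _ ⟨i.π, 0, i.π_ne_zero⟩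

theorem homToV_projClass_of_ne {i j : Irr A} (h : i ≠ j) : homToV k i (projClass j) = 0 := by
  have : ∀ f : j.P →ₗ[A] i.V, f = 0 := fun f => by
    by_contra hf
    exact h (Irr.eq_of_ne_zero f hf).symm
  have : Subsingleton (j.P →ₗ[A] i.V) := ⟨fun f g => by rw [this f, this g]⟩
  rw [homToV, projClass, Grothendieck.lift_cls]
  exact_mod_cast Module.finrank_zero_of_subsingleton

theorem homToV_projClass_self (i : Irr A) : homToV k i (projClass i) ≠ 0 := by
  rw [homToV, projClass, Grothendieck.lift_cls]
  have := finite_hom k (A := A) (P := i.P) (M := i.V)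
  have : Nontrivial (i.P →ₗ[A] i.V) := ⟨i.π, 0, i.π_ne_zero⟩
  exact_mod_cast (Module.finrank_pos (R := k) (M := i.P →ₗ[A] i.V)).ne'

end Bases

section ExplicitBases

open scoped ModuleCat

theorem linearIndependent_irrClass (k : Type v) (A : Type u) [Field k] [Ring A] [Algebra k A]
    [Module.Finite k A] [IsArtinianRing A] : LinearIndependent ℤ (irrClass (A := A)) :=
  linearIndependent_of_pairing _ (homFromP k) (fun _ _ h => homFromP_irrClass_of_ne k h)
    (homFromP_irrClass_self k)

theorem linearIndependent_projClass (k : Type v) (A : Type u) [Field k] [Ring A] [Algebra k A]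
    [Module.Finite k A] [IsArtinianRing A] : LinearIndependent ℤ (projClass (A := A)) :=
  linearIndependent_of_pairing _ (homToV k) (fun _ _ h => homToV_projClass_of_ne k h)
    (homToV_projClass_self k)

theorem cls_mem_span_irrClass {A : Type u} [Ring A] (M : Type u) [AddCommGroup M] [Module A M] (hl : IsFiniteLength A M)
    (hM : Module.Finite A M) :
    (Grothendieck.cls (.of A M) hM : G0 A) ∈ Submodule.span ℤ (Set.range (irrClass (A := A))) := by
  induction hl with
  | @of_subsingleton M _ _ _ =>
    have := Grothendieck.cls_eq_add (C := fun M : ModuleCat.{u} A => Module.Finite A M)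
      (U := .of A M) (V := .of A M) (W := .of A M) hM hM hM (0 : M →ₗ[A] M) 0
      (Function.injective_of_subsingleton _)
      (fun x => by simp [Subsingleton.elim x 0]) (fun x => ⟨0, Subsingleton.elim _ _⟩)
    rw [left_eq_add] at this
    rw [this]
    exact zero_mem _
  | @of_simple_quotient M _ _ N _ hN ih =>
    obtain ⟨i, ⟨e⟩⟩ := Irr.exists_equiv (A := A) (M ⧸ N)
    have := (isFiniteLength_iff_isNoetherian_isArtinian.1 hN).1
    rw [Grothendieck.cls_eq_add (C := fun M : ModuleCat.{u} A => Module.Finite A M)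
      (U := .of A N) (W := .of A i.V) inferInstance hM (inferInstanceAs (Module.Finite A i.V))
      N.subtype (e.toLinearMap ∘ₗ N.mkQ) N.injective_subtype
      (fun x => by simp) (e.surjective.comp N.mkQ_surjective)]
    exact add_mem (ih _) (Submodule.subset_span ⟨i, rfl⟩)

theorem span_irrClass (A : Type u) [Ring A] [IsArtinianRing A] : ⊤ ≤ Submodule.span ℤ (Set.range (irrClass (A := A))) := by
  have h : AddSubgroup.closure {x : G0 A | ∃ M h, x = Grothendieck.cls M h} ≤
      (Submodule.span ℤ (Set.range (irrClass (A := A)))).toAddSubgroup := by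
    rw [AddSubgroup.closure_le]
    rintro _ ⟨M, hM, rfl⟩
    exact cls_mem_span_irrClass M (isFiniteLength_iff_isNoetherian_isArtinian.2
      ⟨inferInstance, inferInstance⟩) hM
  rw [Grothendieck.closure_cls] at h
  exact fun x _ => h (AddSubgroup.mem_top x)

theorem cls_mem_span_projClass (k : Type v) {A : Type u} [Field k] [Ring A] [Algebra k A]
    [Module.Finite k A] [IsArtinianRing A] (n : ℕ) : ∀ (M : ModuleCat.{u} A)
    (hM : Module.Finite A M ∧ Module.Projective A M), Module.finrank k M = n →
    (Grothendieck.cls M hM : K0 A) ∈ Submodule.span ℤ (Set.range (projClass (A := A))) := by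
  induction n using Nat.strong_induction_on with
  | _ n ih =>
    intro M hM hn
    have := hM.1
    have := hM.2
    have := finite_restrict k M
    rcases subsingleton_or_nontrivial M with hs | hnt
    · have := Grothendieck.cls_eq_add
        (C := fun M : ModuleCat.{u} A => Module.Finite A M ∧ Module.Projective A M)
        hM hM hM (0 : M →ₗ[A] M) 0 (Function.injective_of_subsingleton _)
        (fun x => by simp [Subsingleton.elim x 0]) (fun x => ⟨0, Subsingleton.elim _ _⟩)
      rw [left_eq_add] at this
      rw [this]
      exact zero_mem _
    · obtain ⟨N, hN, -⟩ := (eq_top_or_exists_le_coatom (⊥ : Submodule A M)).resolve_left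
        bot_ne_top
      have := isSimpleModule_iff_isCoatom.2 hN
      obtain ⟨i, ⟨e⟩⟩ := Irr.exists_equiv (A := A) (M ⧸ N)
      let q : M →ₗ[A] i.V := e.toLinearMap ∘ₗ N.mkQ
      have hq : Function.Surjective q := e.surjective.comp N.mkQ_surjective
      obtain ⟨φ, hφ⟩ := Module.projective_lifting_property i.π q i.isProjectiveCover.surjective
      have hφs : Function.Surjective φ :=
        i.isProjectiveCover.surjective_of_comp φ (by rw [hφ]; exact hq)
      obtain ⟨s, hs⟩ := Module.projective_lifting_property φ LinearMap.id hφs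
      have hs' : ∀ w, φ (s w) = w := LinearMap.congr_fun hs
      have hproj : Module.Projective A (LinearMap.ker φ) :=
        Module.Projective.of_split (LinearMap.ker φ).subtype
          ((LinearMap.id - s ∘ₗ φ : M →ₗ[A] M).codRestrict _ fun x => by simp [hs'])
          (by ext x; simp)
      have hex : Function.Exact (LinearMap.ker φ).subtype φ := fun x => by simp
      rw [Grothendieck.cls_eq_add
        (C := fun M : ModuleCat.{u} A => Module.Finite A M ∧ Module.Projective A M)
        (U := .of A (LinearMap.ker φ)) (W := .of A i.P) ⟨inferInstance, hproj⟩ hM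
        ⟨inferInstanceAs (Module.Finite A i.P), inferInstanceAs (Module.Projective A i.P)⟩
        (LinearMap.ker φ).subtype φ (Submodule.injective_subtype _) hex hφs]
      refine add_mem (ih _ ?_ _ _ rfl) (Submodule.subset_span ⟨i, rfl⟩)
      have hd := finrank_of_exact k ((LinearMap.ker φ).subtype.restrictScalars k)
        (φ.restrictScalars k) (Submodule.injective_subtype _) hex hφs
      have : Nontrivial i.P := i.nontrivial_P
      have hp : 0 < Module.finrank k i.P := Module.finrank_pos
      refine lt_of_lt_of_le (Nat.lt_add_of_pos_right hp) (le_of_eq ?_)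
      exact hd.symm.trans hn

theorem span_projClass (k : Type v) (A : Type u) [Field k] [Ring A] [Algebra k A]
    [Module.Finite k A] [IsArtinianRing A] : ⊤ ≤ Submodule.span ℤ (Set.range (projClass (A := A))) := by
  have h : AddSubgroup.closure {x : K0 A | ∃ M h, x = Grothendieck.cls M h} ≤
      (Submodule.span ℤ (Set.range (projClass (A := A)))).toAddSubgroup := by
    rw [AddSubgroup.closure_le]
    rintro _ ⟨M, hM, rfl⟩
    exact cls_mem_span_projClass k _ M hM rfl
  rw [Grothendieck.closure_cls] at h
  exact fun x _ => h (AddSubgroup.mem_top x)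

/-- The basis `[V]`, `V` irreducible, of `G₀(A)`. -/
noncomputable def irrBasis (k : Type v) (A : Type u) [Field k] [Ring A] [Algebra k A]
    [Module.Finite k A] [IsArtinianRing A] : Module.Basis (Irr A) ℤ (G0 A) :=
  .mk (linearIndependent_irrClass k A) (span_irrClass A)

/-- The basis `[P]`, `P` a projective cover of an irreducible module, of `K₀(A)`. -/
noncomputable def projBasis (k : Type v) (A : Type u) [Field k] [Ring A] [Algebra k A]
    [Module.Finite k A] [IsArtinianRing A] : Module.Basis (Irr A) ℤ (K0 A) :=
  .mk (linearIndependent_projClass k A) (span_projClass k A)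

theorem finite_irr (k : Type v) (A : Type u) [Field k] [Ring A] [Algebra k A]
    [Module.Finite k A] [IsArtinianRing A] : Finite (Irr A) := by
  let a : G0 A := Grothendieck.cls (.of A A) (inferInstanceAs (Module.Finite A A))
  have ha : ∀ i, homFromP k i a ≠ 0 := by
    intro i
    have := i.nontrivial_P
    obtain ⟨x, hx⟩ := exists_ne (0 : i.P)
    exact homFromP_cls_ne_zero k i _ _
      ⟨Submodule.subtype _, 0, fun h => hx (Subtype.ext (LinearMap.congr_fun h x))⟩
  have hs : ∀ i, i ∈ ((irrBasis k A).repr a).support := by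
    intro i
    by_contra hi
    apply ha i
    rw [← (irrBasis k A).linearCombination_repr a, Finsupp.linearCombination_apply, Finsupp.sum,
      map_sum]
    refine Finset.sum_eq_zero fun j hj => ?_
    have hij : i ≠ j := fun h => hi (h ▸ hj)
    rw [map_zsmul, irrBasis, Module.Basis.mk_apply, homFromP_irrClass_of_ne k hij, smul_zero]
  exact Finite.of_injective (fun i => (⟨i, hs i⟩ : ((irrBasis k A).repr a).support))
    fun i j h => congrArg Subtype.val h

end ExplicitBases

section Cartan

variable (k : Type v) (A : Type u) [Field k] [Ring A] [Algebra k A] [Module.Finite k A]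

noncomputable instance : DecidableEq (Irr A) := Classical.decEq _

/-- The Cartan matrix `C` of `A`: the matrix of the Cartan map `c : K₀(A) → G₀(A)` with respect to
the basis `[P]`, where `P` is the projective cover of `V`, of `K₀(A)`, and the basis `[V]` of
`G₀(A)`, where `V` runs over the irreducible modules. -/
noncomputable def cartanMatrix : Matrix (Irr A) (Irr A) ℤ :=
  haveI := IsArtinianRing.of_finite k A
  letI := @Fintype.ofFinite (Irr A) (finite_irr k A)
  LinearMap.toMatrix (projBasis k A) (irrBasis k A) (cartanMap A)

/-- The determinant of the Cartan matrix. -/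
noncomputable def cartanDet : ℤ :=
  haveI := IsArtinianRing.of_finite k A
  letI := @Fintype.ofFinite (Irr A) (finite_irr k A)
  (cartanMatrix k A).det

end Cartan

section Splitting

/-- `k` is a splitting field for `A`: `End_A(V) = k` for all irreducible `A`-modules `V`. -/
def IsSplittingFieldFor (k : Type v) (A : Type u) [Field k] [Ring A] [Algebra k A] : Prop :=
  ∀ (V : Type u) [AddCommGroup V] [Module A V] [IsSimpleModule A V] (φ : V →ₗ[A] V),
    ∃ c : k, ∀ x : V, φ x = algebraMap k A c • x

end Splitting

end FrobeniusCartan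

/-! Both sides are compared inside `A^*`. Characters give a map `G₀(A) ⊗ k → A^*`, injective because
over a splitting field the irreducible characters are linearly independent
(`characterMap_injective`). The form gives an injection `A → A^*`, `a ↦ β(·, a)`. Let `e_i` be an
idempotent with `A e_i ≅ P_i`. Since `β(b, τ(a)) = tr(x ↦ b x a)`, the element `τ(e_i)` goes to the
character of `P_i` (`flip_form_higmanTrace_idem`). Modulo commutators and the radical `A` is spanned
by the `e_i` (`range_eq_span_idem`), so `im τ` and `im (c ⊗ 1)` both become the span of the
characters of the `P_i`; this is (a).

For (b), evaluating at `e_i` gives `β(e_i, τ(e_j)) = C i j` in `k`, so `τ̃` is injective as soon as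
`det C ≠ 0` in `k`. The radical annihilates `im τ`, so a unit in `im τ` forces semisimplicity. With
`τ̃` injective, the condition on the preimage provides just such a unit. Conversely, if `A` is
semisimple then `P_i = V_i` and `C = 1`. Moreover `τ(∑ e_i)` represents the sum of the irreducible
characters, whose trace form is nondegenerate, so it is a unit. -/

namespace FrobeniusCartan

/-! ### Characters of modules, as a homomorphism from `G₀(A)` to the dual of `A`. -/

section Character

variable (k : Type v) (A : Type u) [Field k] [Ring A] [Algebra k A]

/-- The character `a ↦ tr(a, M)` of an `A`-module `M`. -/
noncomputable def character (M : Type w) [AddCommGroup M] [Module A M] [Module k M]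
    [IsScalarTower k A M] : Module.Dual k A :=
  LinearMap.trace k M ∘ₗ (Algebra.lsmul k k M : A →ₐ[k] Module.End k M).toLinearMap

variable {A}

theorem character_apply (M : Type w) [AddCommGroup M] [Module A M] [Module k M]
    [IsScalarTower k A M] (a : A) :
    character k A M a = LinearMap.trace k M (Algebra.lsmul k k M a) := rfl

theorem character_mul_comm (M : Type w) [AddCommGroup M] [Module A M] [Module k M]
    [IsScalarTower k A M] (a b : A) : character k A M (a * b) = character k A M (b * a) := by
  rw [character_apply, character_apply, map_mul (Algebra.lsmul k k M),
    map_mul (Algebra.lsmul k k M), LinearMap.trace_mul_comm]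

theorem character_eq_zero {M : Type w} [AddCommGroup M] [Module A M] [Module k M]
    [IsScalarTower k A M] {a : A} (h : ∀ x : M, a • x = 0) : character k A M a = 0 := by
  rw [character_apply, show Algebra.lsmul k k M a = 0 from LinearMap.ext h, map_zero]

theorem character_eq_apply {M : Type w} [AddCommGroup M] [Module A M] [Module k M]
    [IsScalarTower k A M] [Module.Finite k M] {a : A} (c : Module.Dual k M) (v : M)
    (h : ∀ x : M, a • x = c x • v) : character k A M a = c v := by
  rw [character_apply, show Algebra.lsmul k k M a = c.smulRight v from LinearMap.ext h,
    LinearMap.trace_smulRight]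

theorem character_congr {M N : Type*} [AddCommGroup M] [Module A M] [Module k M]
    [IsScalarTower k A M] [AddCommGroup N] [Module A N] [Module k N] [IsScalarTower k A N]
    (e : M ≃ₗ[A] N) : character k A M = character k A N := by
  ext a
  rw [character_apply, character_apply, ← LinearMap.trace_conj' _ (e.restrictScalars k)]
  congr 1
  ext x
  simp [LinearEquiv.conj_apply]

/-- The sequence splits over `k`, though perhaps not over `A`. With `k`-linear splittings `r` and
`s`, the identity of `V` is `f r + s g`, and cyclicity of the trace moves each summand to `U` or
`W`. -/
theorem character_of_exact {U V W : Type*} [AddCommGroup U] [AddCommGroup V] [AddCommGroup W]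
    [Module A U] [Module A V] [Module A W] [Module k U] [Module k V] [Module k W]
    [IsScalarTower k A U] [IsScalarTower k A V] [IsScalarTower k A W] [Module.Finite k V]
    (f : U →ₗ[A] V) (g : V →ₗ[A] W)
    (hf : Function.Injective f) (hfg : Function.Exact f g) (hg : Function.Surjective g) :
    character k A V = character k A U + character k A W := by
  have : Module.Finite k U := .of_injective (f.restrictScalars k) hf
  have : Module.Finite k W := .of_surjective (g.restrictScalars k) hg
  obtain ⟨s, hs⟩ := (g.restrictScalars k).exists_rightInverse_of_surjective
    (LinearMap.range_eq_top.2 hg)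
  have hs' : ∀ w, g (s w) = w := LinearMap.congr_fun hs
  let e := LinearEquiv.ofInjective (f.restrictScalars k) hf
  have hr : ∀ x, (LinearMap.id - s ∘ₗ g.restrictScalars k : V →ₗ[k] V) x ∈
      LinearMap.range (f.restrictScalars k) := fun x => (hfg _).1 (by simp [hs'])
  let r : V →ₗ[k] U := e.symm.toLinearMap ∘ₗ LinearMap.codRestrict _ _ hr
  have hfr : ∀ x, f (r x) = x - s (g x) := fun x =>
    congrArg Subtype.val (e.apply_symm_apply ⟨_, hr x⟩)
  have hrf : ∀ x, r (f x) = x := fun x => hf <| by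
    rw [hfr, hfg.apply_apply_eq_zero, map_zero, sub_zero]
  ext a
  rw [LinearMap.add_apply, character_apply, character_apply, character_apply]
  have hV : Algebra.lsmul k k V a = (Algebra.lsmul k k V a ∘ₗ f.restrictScalars k) ∘ₗ r +
      (Algebra.lsmul k k V a ∘ₗ s) ∘ₗ g.restrictScalars k := by
    ext x
    simp only [LinearMap.add_apply, LinearMap.comp_apply, LinearMap.coe_restrictScalars, hfr,
      map_sub, sub_add_cancel]
  have hU : Algebra.lsmul k k U a = r ∘ₗ Algebra.lsmul k k V a ∘ₗ f.restrictScalars k := by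
    ext x
    change a • x = r (a • f x)
    rw [← map_smul, hrf]
  have hW : Algebra.lsmul k k W a = g.restrictScalars k ∘ₗ Algebra.lsmul k k V a ∘ₗ s := by
    ext x
    simp [hs']
  rw [hV, map_add, LinearMap.trace_comp_comm', hU, hW,
    LinearMap.trace_comp_comm' (g.restrictScalars k)]

variable (A) [Module.Finite k A]

open scoped ModuleCat in
/-- The homomorphism `G₀(A) → A^*` given by the characters of modules. -/
noncomputable def characterHom : G0 A →+ Module.Dual k A :=
  Grothendieck.lift (fun M => character k A M.1) <| by
    rintro ⟨U, hU⟩ ⟨V, hV⟩ ⟨W, hW⟩ f g hf hfg hg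
    have := finite_restrict k V
    exact character_of_exact k f g hf hfg hg

-- An object of `ModuleCat A` has the `k`-structure restricted along `k → A`, while `i.V` and `i.P`
-- have their own; `e` lets the character be computed with any compatible structure.
open scoped ModuleCat in
variable {A} in
theorem characterHom_cls (M : ModuleCat.{u} A) (h : Module.Finite A M) {N : Type*}
    [AddCommGroup N] [Module A N] [Module k N] [IsScalarTower k A N] (e : M ≃ₗ[A] N) :
    characterHom k A (Grothendieck.cls M h) = character k A N := by
  rw [characterHom, Grothendieck.lift_cls]
  exact character_congr k e

/-- The `k`-linear map `G₀(A) ⊗ k → A^*` given by the characters of modules. -/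
noncomputable def characterMap : TensorProduct ℤ k (G0 A) →ₗ[k] Module.Dual k A :=
  LinearMap.liftBaseChange k (characterHom k A).toIntLinearMap

theorem characterMap_tmul (c : k) (x : G0 A) :
    characterMap k A (c ⊗ₜ x) = c • characterHom k A x := rfl

end Character

/-! ### Primitive idempotents attached to the irreducible modules. -/

section Idempotent

variable {A : Type u} [Ring A]

namespace Irr

/-- The generator of `V = A / m` given by `1`. -/
noncomputable def gen (i : Irr A) : i.V := i.ideal.mkQ 1

theorem gen_ne_zero (i : Irr A) : i.gen ≠ 0 := by
  rw [gen, Ne, Submodule.mkQ_apply, Submodule.Quotient.mk_eq_zero, ← Ideal.eq_top_iff_one]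
  exact Ideal.IsMaximal.ne_top inferInstance

/-- The radical is the intersection of the maximal left ideals; being two-sided, it annihilates
every `A / m` and not only the class of `1`. -/
theorem forall_smul_eq_zero_iff {a : A} :
    (∀ (i : Irr A) (x : i.V), a • x = 0) ↔ a ∈ Ring.jacobson A := by
  refine ⟨fun h => ?_, fun h i x => ?_⟩
  · refine (Ideal.mem_sInf).2 fun {m : Ideal A} hm => ?_
    have : IsSimpleModule A (A ⧸ m) := isSimpleModule_iff_isCoatom.2 hm
    obtain ⟨i, ⟨e⟩⟩ := exists_equiv (A := A) (A ⧸ m)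
    have h1 : a • (m.mkQ 1) = 0 := e.injective (by rw [map_smul, h, map_zero])
    rwa [← map_smul, Submodule.mkQ_apply, Submodule.Quotient.mk_eq_zero, smul_eq_mul,
      mul_one] at h1
  · obtain ⟨b, rfl⟩ := i.ideal.mkQ_surjective x
    rw [← map_smul, Submodule.mkQ_apply, Submodule.Quotient.mk_eq_zero]
    have hab : a * b ∈ Ring.jacobson A := Ideal.mul_mem_right _ _ h
    exact Ideal.mem_sInf.1 hab (Ideal.isMaximal_def.1 inferInstance)

variable [IsArtinianRing A]

theorem exists_cover (i : Irr A) : ∃ φ : A →ₗ[A] i.P, i.π ∘ₗ φ = i.ideal.mkQ :=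
  Module.projective_lifting_property i.π i.ideal.mkQ i.isProjectiveCover.surjective

/-- A lift `A → P` of the canonical map `A → A / m`, where `P` is the projective cover
of `A / m`. -/
noncomputable def cover (i : Irr A) : A →ₗ[A] i.P := i.exists_cover.choose

theorem π_cover (i : Irr A) (a : A) : i.π (i.cover a) = i.ideal.mkQ a :=
  LinearMap.congr_fun i.exists_cover.choose_spec a

theorem cover_surjective (i : Irr A) : Function.Surjective i.cover :=
  i.isProjectiveCover.surjective_of_comp _ <| by
    rw [cover, i.exists_cover.choose_spec]
    exact Submodule.mkQ_surjective _

theorem exists_incl (i : Irr A) : ∃ s : i.P →ₗ[A] A, i.cover ∘ₗ s = LinearMap.id :=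
  Module.projective_lifting_property i.cover LinearMap.id i.cover_surjective

/-- An embedding `P → A` that splits `cover`. -/
noncomputable def incl (i : Irr A) : i.P →ₗ[A] A := i.exists_incl.choose

theorem cover_incl (i : Irr A) (p : i.P) : i.cover (i.incl p) = p :=
  LinearMap.congr_fun i.exists_incl.choose_spec p

/-- A primitive idempotent `e` with `P ≅ A e`. -/
noncomputable def idem (i : Irr A) : A := i.incl (i.cover 1)

/-- An endomorphism of the left module `A` is right multiplication by the image of `1`. -/
theorem incl_cover (i : Irr A) (a : A) : i.incl (i.cover a) = a * i.idem := by
  rw [idem, ← smul_eq_mul, ← map_smul, ← map_smul, smul_eq_mul, mul_one]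

theorem idem_mul_idem (i : Irr A) : i.idem * i.idem = i.idem := by
  rw [← incl_cover]
  conv_lhs => rw [idem, cover_incl]
  rfl

theorem π_cover_one (i : Irr A) : i.π (i.cover 1) = i.gen := i.π_cover 1

theorem idem_smul_gen (i : Irr A) : i.idem • i.gen = i.gen := by
  rw [← π_cover_one, ← map_smul, ← map_smul, smul_eq_mul, mul_one]
  exact congrArg i.π (i.cover_incl _)

/-- A nonzero `e_j x` would give a nonzero map `P_j → V_i`, but `V_j` is the only simple quotient of
`P_j`. -/
theorem idem_smul_of_ne {i j : Irr A} (h : j ≠ i) (x : i.V) : j.idem • x = 0 := by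
  by_contra hx
  refine h (eq_of_ne_zero ((LinearMap.toSpanSingleton A i.V x) ∘ₗ j.incl) fun h0 => hx ?_)
  exact LinearMap.congr_fun h0 (j.cover 1)

section Splitting

variable {k : Type v} [Field k] [Algebra k A]

/-- A nonzero `f` has a maximal kernel, which must equal the superfluous maximal submodule `ker π`.
So `f` factors through an endomorphism of `V`, a scalar by the splitting hypothesis. -/
theorem exists_eq_smul_π (hk : IsSplittingFieldFor k A) {i : Irr A} (f : i.P →ₗ[A] i.V) :
    ∃ c : k, ∀ p, f p = c • i.π p := by
  by_cases hf : f = 0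
  · exact ⟨0, by simp [hf]⟩
  have hs : Function.Surjective f := LinearMap.surjective_of_ne_zero hf
  have h1 : IsCoatom (LinearMap.ker f) :=
    isSimpleModule_iff_isCoatom.1 (.congr (f.quotKerEquivOfSurjective hs))
  have h2 : IsCoatom (LinearMap.ker i.π) := isSimpleModule_iff_isCoatom.1
    (.congr (i.π.quotKerEquivOfSurjective i.isProjectiveCover.surjective))
  have h3 : LinearMap.ker i.π = LinearMap.ker f := by
    by_contra hne
    exact h1.1 (i.isProjectiveCover.superfluous _ (h1.sup_eq_top_of_ne h2 (Ne.symm hne)))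
  let φ : i.V →ₗ[A] i.V := (LinearMap.ker i.π).liftQ f h3.le ∘ₗ
    (i.π.quotKerEquivOfSurjective i.isProjectiveCover.surjective).symm.toLinearMap
  obtain ⟨c, hc⟩ := hk i.V φ
  refine ⟨c, fun p => ?_⟩
  rw [← algebraMap_smul A c, ← hc]
  have : (i.π.quotKerEquivOfSurjective i.isProjectiveCover.surjective).symm (i.π p) =
      (LinearMap.ker i.π).mkQ p := by
    rw [LinearEquiv.symm_apply_eq]
    rfl
  simp only [φ, LinearMap.comp_apply, LinearEquiv.coe_coe, this]
  rfl

/-- `e x` is the value at `cover 1` of the map `P → V`, `p ↦ incl p • x`, which is a multiple of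
`π`. Hence `e` acts on `V` with rank one, and traces of `e a` on `V` become explicit. -/
theorem exists_coord (hk : IsSplittingFieldFor k A) (i : Irr A) :
    ∃ c : Module.Dual k i.V, c i.gen = 1 ∧ ∀ x, i.idem • x = c x • i.gen := by
  obtain ⟨g, hg⟩ := Module.Projective.exists_dual_eq_one k i.gen_ne_zero
  refine ⟨g ∘ₗ Algebra.lsmul k k i.V i.idem, ?_, fun x => ?_⟩
  · exact (congrArg g i.idem_smul_gen).trans hg
  · obtain ⟨c, hc⟩ := exists_eq_smul_π hk ((LinearMap.toSpanSingleton A i.V x) ∘ₗ i.incl)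
    have hx : i.idem • x = c • i.gen := (hc (i.cover 1)).trans (by rw [π_cover_one])
    have hgx : (g ∘ₗ Algebra.lsmul k k i.V i.idem) x = c := by
      refine (congrArg g hx).trans ?_
      rw [map_smul, hg, smul_eq_mul, mul_one]
    rw [hgx, hx]

/-- The `k`-linear form `c` on `V` with `e x = c(x) v`, where `v` is the generator of `V`. -/
noncomputable def coord (hk : IsSplittingFieldFor k A) (i : Irr A) : Module.Dual k i.V :=
  (exists_coord hk i).choose

theorem coord_gen (hk : IsSplittingFieldFor k A) (i : Irr A) : coord hk i i.gen = 1 :=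
  (exists_coord hk i).choose_spec.1

theorem idem_smul (hk : IsSplittingFieldFor k A) (i : Irr A) (x : i.V) :
    i.idem • x = coord hk i x • i.gen :=
  (exists_coord hk i).choose_spec.2 x

theorem character_idem_mul_of_ne {i j : Irr A} (h : j ≠ i) (a : A) :
    character k A i.V (j.idem * a) = 0 := by
  exact character_eq_zero k fun x => by rw [mul_smul, idem_smul_of_ne h]

theorem character_idem_mul_self [Module.Finite k A] (hk : IsSplittingFieldFor k A) (i : Irr A)
    (a : A) : character k A i.V (i.idem * a) = coord hk i (a • i.gen) := by
  have : Module.Finite k i.V := Module.Finite.trans A i.V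
  exact character_eq_apply k (coord hk i ∘ₗ Algebra.lsmul k k i.V a) i.gen fun x => by
    rw [mul_smul, idem_smul hk]
    rfl

theorem character_idem [Module.Finite k A] (hk : IsSplittingFieldFor k A) (i j : Irr A) :
    character k A i.V j.idem = if j = i then 1 else 0 := by
  rw [← mul_one j.idem]
  split_ifs with h
  · subst h
    rw [character_idem_mul_self hk, one_smul, coord_gen]
  · exact character_idem_mul_of_ne h 1

theorem linearIndependent_character [Module.Finite k A] (hk : IsSplittingFieldFor k A) :
    LinearIndependent k fun i : Irr A => character k A i.V := by
  rw [linearIndependent_iff']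
  intro s g hg i hi
  simpa [character_idem hk, hi] using LinearMap.congr_fun hg i.idem

/-- No maximal left ideal `m` contains all `e_i b`: if `A / m ≅ V_i` and `b` lifts the vector
corresponding to the generator of `V_i`, then `e_i b ∉ m`. -/
theorem span_mul_idem_mul :
    Submodule.span k {x : A | ∃ (i : Irr A) (a b : A), x = a * i.idem * b} = ⊤ := by
  let I : Ideal A := Ideal.span {x : A | ∃ (i : Irr A) (b : A), x = i.idem * b}
  have hI : I = ⊤ := by
    by_contra h
    obtain ⟨m, hm, hIm⟩ := Ideal.exists_le_maximal I h
    have : IsSimpleModule A (A ⧸ m) := isSimpleModule_iff_isCoatom.2 (Ideal.isMaximal_def.1 hm)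
    obtain ⟨i, ⟨e⟩⟩ := exists_equiv (A := A) (A ⧸ m)
    obtain ⟨b, hb⟩ := m.mkQ_surjective (e.symm i.gen)
    apply i.gen_ne_zero
    rw [← idem_smul_gen, ← e.apply_symm_apply i.gen, ← hb, ← map_smul, ← map_smul,
      smul_eq_mul, Submodule.mkQ_apply, (Submodule.Quotient.mk_eq_zero _).2, map_zero]
    exact hIm (Ideal.subset_span ⟨i, b, rfl⟩)
  refine eq_top_iff.2 fun x _ => ?_
  have hx : x ∈ I := hI ▸ Submodule.mem_top
  induction hx using Submodule.span_induction with
  | mem x h =>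
    obtain ⟨i, b, rfl⟩ := h
    exact Submodule.subset_span ⟨i, 1, b, by rw [one_mul]⟩
  | zero => exact zero_mem _
  | add x y _ _ hx hy => exact add_mem (hx trivial) (hy trivial)
  | smul a x _ hx =>
    have hle : Submodule.span k {x : A | ∃ (i : Irr A) (a b : A), x = a * i.idem * b} ≤
        (Submodule.span k {x : A | ∃ (i : Irr A) (a b : A), x = a * i.idem * b}).comap
          (LinearMap.mulLeft k a) := by
      rw [Submodule.span_le]
      rintro _ ⟨i, c, d, rfl⟩
      exact Submodule.subset_span ⟨i, a * c, d, by simp [mul_assoc]⟩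
    exact hle (hx trivial)

/-- `e A e` is `k e` modulo the radical. This can be tested on irreducible modules, where `e` is
zero or has rank one. -/
theorem exists_idem_mul_mul_idem_sub_mem (hk : IsSplittingFieldFor k A) (i : Irr A) (a : A) :
    ∃ c : k, i.idem * a * i.idem - c • i.idem ∈ Ring.jacobson A := by
  refine ⟨coord hk i (a • i.gen), forall_smul_eq_zero_iff.1 fun j x => ?_⟩
  rw [sub_smul, smul_assoc, mul_smul, mul_smul]
  by_cases h : i = j
  · subst h
    rw [idem_smul hk i x, smul_comm a, smul_comm i.idem, idem_smul hk i (a • _), smul_comm,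
      sub_self]
  · rw [idem_smul_of_ne h, idem_smul_of_ne h, smul_zero, sub_self]

/-- A linear map that vanishes on commutators and on the radical is determined by its values on
the primitive idempotents. -/
theorem range_eq_span_idem (hk : IsSplittingFieldFor k A) {M : Type*} [AddCommGroup M] [Module k M]
    (f : A →ₗ[k] M) (hc : ∀ a b, f (a * b) = f (b * a)) (hr : ∀ a ∈ Ring.jacobson A, f a = 0) :
    LinearMap.range f = Submodule.span k (Set.range fun i : Irr A => f i.idem) := by
  refine le_antisymm ?_ (Submodule.span_le.2 ?_)
  · rw [LinearMap.range_eq_map, ← span_mul_idem_mul, Submodule.map_span, Submodule.span_le]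
    rintro _ ⟨_, ⟨i, a, b, rfl⟩, rfl⟩
    obtain ⟨c, hc'⟩ := exists_idem_mul_mul_idem_sub_mem hk i (b * a)
    -- Since `e² = e` and `f` is cyclic, `f(a e b) = f(e b a e)`, and `e b a e ≡ c e` modulo the
    -- radical.
    have h1 : f (a * i.idem * b) = c • f i.idem := by
      rw [← map_smul, ← sub_eq_zero, ← hr _ hc', map_sub, ← idem_mul_idem, ← mul_assoc, mul_assoc _ _ b,
        hc, ← mul_assoc, mul_assoc _ b a, idem_mul_idem]
    rw [SetLike.mem_coe, h1]
    exact Submodule.smul_mem _ _ (Submodule.subset_span ⟨i, rfl⟩)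
  · rintro _ ⟨i, rfl⟩
    exact ⟨i.idem, rfl⟩

end Splitting

end Irr

end Idempotent

/-! ### The Cartan map seen through characters. -/

section CharacterMap

variable {k : Type v} {A : Type u} [Field k] [Ring A] [Algebra k A] [Module.Finite k A]

theorem characterHom_irrClass (i : Irr A) :
    characterHom k A (irrClass i) = character k A i.V :=
  characterHom_cls k _ _ (LinearEquiv.refl A _)

variable [IsArtinianRing A]

theorem characterHom_cartanMap_projClass (i : Irr A) :
    characterHom k A (cartanMap A (projClass i)) = character k A i.P := by
  rw [cartanMap, AddMonoidHom.coe_toIntLinearMap, projClass, Grothendieck.map_cls]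
  exact characterHom_cls k _ _ (LinearEquiv.refl A _)

theorem characterMap_injective (hk : IsSplittingFieldFor k A) :
    Function.Injective (characterMap k A) := by
  let b := (irrBasis k A).baseChange k
  have hb : characterMap k A =
      Finsupp.linearCombination k (fun i : Irr A => character k A i.V) ∘ₗ b.repr.toLinearMap := by
    refine b.ext fun i => ?_
    rw [LinearMap.comp_apply, LinearEquiv.coe_coe, b.repr_self,
      Finsupp.linearCombination_single, one_smul, Module.Basis.baseChange_apply,
      characterMap_tmul, one_smul, irrBasis, Module.Basis.mk_apply, characterHom_irrClass]
  rw [hb]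
  rw [LinearMap.coe_comp]
  exact Function.Injective.comp (Irr.linearIndependent_character hk) b.repr.injective

theorem range_characterMap_comp_cartanMap :
    LinearMap.range (characterMap k A ∘ₗ (cartanMap A).baseChange k) =
      Submodule.span k (Set.range fun i : Irr A => character k A i.P) := by
  let b := (projBasis k A).baseChange k
  rw [LinearMap.range_eq_map, ← b.span_eq, Submodule.map_span, ← Set.range_comp]
  congr 2
  ext1 i
  rw [Function.comp_apply, Module.Basis.baseChange_apply, LinearMap.comp_apply,
    LinearMap.baseChange_tmul, characterMap_tmul, one_smul, projBasis, Module.Basis.mk_apply,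
    characterHom_cartanMap_projClass]

theorem cartanMatrix_apply (i j : Irr A) :
    cartanMatrix k A i j = (irrBasis k A).repr (cartanMap A (projClass j)) i := by
  let _ := @Fintype.ofFinite (Irr A) (finite_irr k A)
  rw [cartanMatrix, LinearMap.toMatrix_apply, projBasis, Module.Basis.mk_apply]

/-- The trace of `e_i` on `V_j` is `δ_ij`, so evaluation at `e_i` reads off the coefficient of
`[V_i]`, as an element of `k`. -/
theorem characterHom_apply_idem (hk : IsSplittingFieldFor k A) (x : G0 A) (i : Irr A) :
    characterHom k A x i.idem = ((irrBasis k A).repr x i : k) := by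
  obtain ⟨c, rfl⟩ := (irrBasis k A).repr.symm.surjective x
  rw [LinearEquiv.apply_symm_apply]
  induction c using Finsupp.induction_linear with
  | zero => simp
  | add c d hc hd =>
    rw [map_add, map_add, LinearMap.add_apply, hc, hd, Finsupp.add_apply, Int.cast_add]
  | single j n =>
    rw [Module.Basis.repr_symm_single, map_zsmul, irrBasis, Module.Basis.mk_apply,
      characterHom_irrClass, LinearMap.smul_apply, Irr.character_idem hk, Finsupp.single_apply]
    by_cases h : j = i
    · simp [h]
    · simp [h, Ne.symm h]

theorem character_P_idem (hk : IsSplittingFieldFor k A) (i j : Irr A) :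
    character k A j.P i.idem = cartanMatrix k A i j := by
  rw [← characterHom_cartanMap_projClass, cartanMatrix_apply, characterHom_apply_idem hk]

end CharacterMap

/-! ### The Higman trace and its relation to the Cartan matrix. -/

namespace FrobeniusForm

variable {k : Type v} {A : Type u} [Field k] [Ring A] [Algebra k A]

theorem can_surjective : Function.Surjective (can (k := k) (A := A)) :=
  (Submodule.mkQ_surjective _).comp Ideal.Quotient.mk_surjective

theorem can_mul_comm (a b : A) : can (k := k) (a * b) = can (b * a) := by
  rw [← sub_eq_zero, ← map_sub]
  exact (Submodule.Quotient.mk_eq_zero _).2 (Submodule.subset_span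
    ⟨Ideal.Quotient.mk _ a, Ideal.Quotient.mk _ b, by simp⟩)

theorem can_eq_zero {a : A} (ha : a ∈ Ring.jacobson A) : can (k := k) a = 0 := by
  have : (Ideal.Quotient.mkₐ k (Ring.jacobson A)) a = 0 := Ideal.Quotient.eq_zero_iff_mem.2 ha
  rw [can, LinearMap.comp_apply, AlgHom.toLinearMap_apply, this, map_zero]

variable (β : FrobeniusForm k A)

theorem flip_form_injective : Function.Injective (LinearMap.flip β.form) :=
  (injective_iff_map_eq_zero _).2 fun a ha => β.nondegenerate.2 a (LinearMap.congr_fun ha)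

variable [Module.Finite k A]

theorem higmanTrace_mul_comm (a b : A) : β.higmanTrace (a * b) = β.higmanTrace (b * a) := by
  rw [← sub_eq_zero, ← map_sub, higmanTrace_commutator]

/-- `β(c, b τ(a)) = β(c b, τ(a))` is the trace of `x ↦ c b x a`, which is nilpotent because `c b` is
and left and right multiplications commute. -/
theorem mul_higmanTrace_eq_zero {b : A} (hb : b ∈ Ring.jacobson A) (a : A) :
    b * β.higmanTrace a = 0 := by
  have : IsArtinianRing A := IsArtinianRing.of_finite k A
  obtain ⟨n, hn⟩ := (inferInstance : IsSemiprimaryRing A).isNilpotent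
  refine β.nondegenerate.2 _ fun c => ?_
  have hcb : (c * b) ^ n = 0 := by
    have := Ideal.pow_mem_pow (Ideal.mul_mem_left _ c hb) n
    rwa [hn] at this
  rw [← β.assoc, form_higmanTrace]
  have hnil : IsNilpotent (LinearMap.mulLeft k (c * b) * LinearMap.mulRight k a) := by
    refine Commute.isNilpotent_mul_right ?_ ⟨n, ?_⟩
    · ext z; simp [mul_assoc]
    · rw [LinearMap.pow_mulLeft, hcb, LinearMap.mulLeft_zero_eq_zero]
  exact (LinearMap.isNilpotent_trace_of_isNilpotent hnil).eq_zero

theorem isSemisimpleRing_of_isUnit {a : A} (ha : IsUnit (β.higmanTrace a)) :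
    IsSemisimpleRing A := by
  have : IsArtinianRing A := IsArtinianRing.of_finite k A
  rw [IsArtinianRing.isSemisimpleRing_iff_jacobson, eq_bot_iff]
  exact fun b hb => ha.mul_left_eq_zero.1 (β.mul_higmanTrace_eq_zero hb a)

variable [IsArtinianRing A]

/-- Right multiplication by `e` is `incl ∘ cover`, so cyclicity turns the trace of `x ↦ b x e` on
`A` into the trace of `b` on `P`. -/
theorem flip_form_higmanTrace_idem (i : Irr A) :
    (LinearMap.flip β.form) (β.higmanTrace i.idem) = character k A i.P := by
  have : Module.Finite k i.P := Module.Finite.trans A i.P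
  ext b
  rw [LinearMap.flip_apply, form_higmanTrace, character_apply]
  have h1 : LinearMap.mulLeft k b * LinearMap.mulRight k i.idem =
      (i.incl.restrictScalars k ∘ₗ Algebra.lsmul k k i.P b) ∘ₗ i.cover.restrictScalars k := by
    refine LinearMap.ext fun x => ?_
    change b * (x * i.idem) = i.incl (b • i.cover x)
    rw [map_smul, Irr.incl_cover, smul_eq_mul]
  have h2 : i.cover.restrictScalars k ∘ₗ i.incl.restrictScalars k ∘ₗ Algebra.lsmul k k i.P b =
      Algebra.lsmul k k i.P b := LinearMap.ext fun x => i.cover_incl _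
  rw [h1, LinearMap.trace_comp_comm', h2]

theorem form_idem_higmanTrace_idem (hk : IsSplittingFieldFor k A) (i j : Irr A) :
    β.form i.idem (β.higmanTrace j.idem) = cartanMatrix k A i j := by
  rw [← character_P_idem hk, ← β.flip_form_higmanTrace_idem, LinearMap.flip_apply]

/-- The rank of `c ⊗ 1` equals the rank of the Higman trace. -/
theorem finrank_range_cartanMap (hk : IsSplittingFieldFor k A) :
    Module.finrank k (LinearMap.range ((cartanMap A).baseChange k)) =
      Module.finrank k (LinearMap.range β.higmanTrace) := by
  have h1 : LinearMap.range ((LinearMap.flip β.form) ∘ₗ β.higmanTrace) =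
      Submodule.span k (Set.range fun i : Irr A => character k A i.P) := by
    rw [Irr.range_eq_span_idem hk ((LinearMap.flip β.form) ∘ₗ β.higmanTrace)
      (fun a b => congrArg (LinearMap.flip β.form) (β.higmanTrace_mul_comm a b))
      fun a ha => by rw [LinearMap.comp_apply, β.higmanTrace_jacobson ha, map_zero]]
    simp_rw [LinearMap.comp_apply, flip_form_higmanTrace_idem]
  have h2 := h1.trans range_characterMap_comp_cartanMap.symm
  rw [LinearMap.range_comp, LinearMap.range_comp] at h2
  -- Both embeddings into `A^*` are injective, so they preserve the two ranks, and their images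
  -- agree by `h2`.
  rw [LinearEquiv.finrank_eq (Submodule.equivMapOfInjective _ (characterMap_injective hk) _),
    ← h2, ← LinearEquiv.finrank_eq (Submodule.equivMapOfInjective _ β.flip_form_injective _)]

/-- The classes of the `e_j` span `T(A / rad A)`. If `∑ c_j e_j` maps to `0`, pairing with each
`e_i` gives `C c = 0` over `k`. -/
theorem higmanTraceTilde_injective (hk : IsSplittingFieldFor k A)
    (hC : (cartanDet k A : k) ≠ 0) : Function.Injective β.higmanTraceTilde := by
  let _ := @Fintype.ofFinite (Irr A) (finite_irr k A)
  refine (injective_iff_map_eq_zero _).2 fun t ht => ?_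
  have hspan : t ∈ LinearMap.range (can (k := k) (A := A)) := can_surjective t
  rw [Irr.range_eq_span_idem hk _ can_mul_comm fun _ => can_eq_zero,
    Submodule.mem_span_range_iff_exists_fun] at hspan
  obtain ⟨c, rfl⟩ := hspan
  have hdet : ((cartanMatrix k A).map (Int.castRingHom k)).det ≠ 0 := by
    rw [← RingHom.mapMatrix_apply, ← RingHom.map_det]
    exact hC
  have hc : c = 0 := by
    refine Matrix.eq_zero_of_mulVec_eq_zero hdet (funext fun i => ?_)
    have h := congrArg (β.form i.idem) ht
    simpa [higmanTraceTilde_can, β.form_idem_higmanTrace_idem hk, Matrix.mulVec, dotProduct,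
      mul_comm] using h
  simp [hc]

end FrobeniusForm

/-! ### Semisimplicity, the identity Cartan matrix and units in the image of the Higman trace. -/

section Semisimple

variable {k : Type v} {A : Type u} [Field k] [Ring A] [Algebra k A] [Module.Finite k A]

/-- The relations only mention exact sequences, so `0 → 0 → M → N → 0` is used, together with `[0] =
[0] + [0]`. -/
theorem cls_eq_of_equiv {M N : ModuleCat.{u} A} (hM : Module.Finite A M) (hN : Module.Finite A N)
    (e : M ≃ₗ[A] N) : (Grothendieck.cls M hM : G0 A) = Grothendieck.cls N hN := by
  have hZ : Module.Finite A (ModuleCat.of A PUnit.{u + 1}) :=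
    inferInstanceAs (Module.Finite A PUnit.{u + 1})
  have h0 := Grothendieck.cls_eq_add (C := fun M : ModuleCat.{u} A => Module.Finite A M)
    (U := .of A PUnit.{u + 1}) (V := .of A PUnit.{u + 1}) (W := .of A PUnit.{u + 1}) hZ hZ hZ
    (0 : PUnit.{u + 1} →ₗ[A] PUnit.{u + 1}) (0 : PUnit.{u + 1} →ₗ[A] PUnit.{u + 1})
    (Function.injective_of_subsingleton _)
    (fun x => by simp [Subsingleton.elim x 0]) (fun x => ⟨0, Subsingleton.elim _ _⟩)
  rw [left_eq_add] at h0
  rw [Grothendieck.cls_eq_add (C := fun M : ModuleCat.{u} A => Module.Finite A M)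
    (U := .of A PUnit.{u + 1}) hZ hM hN (0 : PUnit.{u + 1} →ₗ[A] M) e.toLinearMap
    (Function.injective_of_subsingleton _) (fun x => ?_) e.surjective, h0, zero_add]
  exact e.map_eq_zero_iff.trans ⟨fun h => ⟨0, h.symm⟩, fun ⟨_, h⟩ => h.symm⟩

/-- A superfluous submodule that has a complement is zero. -/
theorem Irr.π_injective [IsArtinianRing A] [IsSemisimpleRing A] (i : Irr A) :
    Function.Injective i.π := by
  obtain ⟨N, hN⟩ := exists_isCompl (LinearMap.ker i.π)
  have := i.isProjectiveCover.superfluous N hN.symm.sup_eq_top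
  rw [this] at hN
  exact LinearMap.ker_eq_bot.1 (by simpa using hN.inf_eq_bot)

theorem cartanMatrix_eq_one [IsSemisimpleRing A] : cartanMatrix k A = 1 := by
  have : IsArtinianRing A := IsArtinianRing.of_finite k A
  ext i j
  have h : cartanMap A (projClass j) = irrBasis k A j := by
    rw [cartanMap, AddMonoidHom.coe_toIntLinearMap, projClass, Grothendieck.map_cls, irrBasis,
      Module.Basis.mk_apply]
    exact cls_eq_of_equiv _ _
      (LinearEquiv.ofBijective j.π ⟨j.π_injective, j.isProjectiveCover.surjective⟩)
  rw [cartanMatrix_apply, h, Module.Basis.repr_self, Finsupp.single_apply, Matrix.one_apply]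
  exact if_congr eq_comm rfl rfl

/-- If `c` does not kill the generator `v` of `V_j`, choose `b` with `b c v = v`; then `e_j b c` has
trace `1` on `V_j` and `0` on the other irreducibles. -/
theorem Irr.eq_zero_of_sum_character_mul [IsArtinianRing A] [IsSemisimpleRing A]
    [Fintype (Irr A)] (hk : IsSplittingFieldFor k A) {a : A}
    (h : ∀ b, ∑ i : Irr A, character k A i.V (b * a) = 0) : a = 0 := by
  have key : ∀ c : A, (∀ b, ∑ i : Irr A, character k A i.V (b * c) = 0) →
      ∀ j : Irr A, c • j.gen = 0 := by
    intro c hc j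
    by_contra hne
    obtain ⟨b, hb⟩ := IsSimpleModule.toSpanSingleton_surjective A hne j.gen
    have hj := hc (j.idem * b)
    simp_rw [mul_assoc] at hj
    rw [Finset.sum_eq_single j (fun i _ hi => character_idem_mul_of_ne hi.symm _)
      fun hj => absurd (Finset.mem_univ j) hj, character_idem_mul_self hk, mul_smul,
      show b • c • j.gen = j.gen from hb, coord_gen] at hj
    exact one_ne_zero hj
  suffices a ∈ Ring.jacobson A by rwa [IsSemisimpleRing.jacobson_eq_bot] at this
  refine forall_smul_eq_zero_iff.1 fun j x => ?_
  obtain ⟨d, rfl⟩ := j.ideal.mkQ_surjective x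
  have hd : j.ideal.mkQ d = d • j.gen := by
    rw [gen, ← map_smul, smul_eq_mul, mul_one]
  rw [hd, ← mul_smul]
  -- The hypothesis passes from `a` to `a d` by cyclicity, so every vector `d v` is reached.
  refine key _ (fun b => ?_) j
  rw [← h (d * b)]
  refine Finset.sum_congr rfl fun i _ => ?_
  rw [← mul_assoc, character_mul_comm, mul_assoc]

theorem FrobeniusForm.isUnit_higmanTrace_sum_idem [IsArtinianRing A] [IsSemisimpleRing A]
    [Fintype (Irr A)] (hk : IsSplittingFieldFor k A) (β : FrobeniusForm k A) :
    IsUnit (β.higmanTrace (∑ i : Irr A, i.idem)) := by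
  set t := β.higmanTrace (∑ i : Irr A, i.idem) with ht
  have hform : ∀ b, β.form b t = ∑ i : Irr A, character k A i.V b := by
    intro b
    rw [ht, map_sum, map_sum]
    refine Finset.sum_congr rfl fun i _ => ?_
    rw [← LinearMap.flip_apply, flip_form_higmanTrace_idem]
    exact LinearMap.congr_fun (character_congr k
      (LinearEquiv.ofBijective i.π ⟨i.π_injective, i.isProjectiveCover.surjective⟩)) b
  -- If `c t = 0`, then `β(b c, t) = β(b, c t) = 0` for all `b`, so `c` lies in the radical of the
  -- trace form.
  have hinj : Function.Injective (LinearMap.mulRight k t) := by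
    refine (injective_iff_map_eq_zero _).2 fun c hc => ?_
    refine Irr.eq_zero_of_sum_character_mul hk fun b => ?_
    rw [← hform, β.assoc, show c * t = 0 from hc, map_zero]
  obtain ⟨d, hd⟩ := LinearMap.injective_iff_surjective.1 hinj 1
  exact IsUnit.of_mul_eq_one_right d hd

theorem FrobeniusForm.preimage_higmanTraceTilde_ne [Nontrivial A] [IsSemisimpleRing A]
    (hk : IsSplittingFieldFor k A) (β : FrobeniusForm k A) :
    β.higmanTraceTilde ⁻¹' ({a | IsUnit a} ∪ {0}) ≠ {0} := by
  have : IsArtinianRing A := IsArtinianRing.of_finite k A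
  let _ := @Fintype.ofFinite (Irr A) (finite_irr k A)
  have hu := β.isUnit_higmanTrace_sum_idem hk
  rw [← higmanTraceTilde_can] at hu
  intro h
  have h0 : can (∑ i : Irr A, i.idem) ∈ β.higmanTraceTilde ⁻¹' ({a | IsUnit a} ∪ {0}) := Or.inl hu
  rw [h, Set.mem_singleton_iff] at h0
  rw [h0, map_zero] at hu
  exact not_isUnit_zero hu

/-- Unless `A` is semisimple, `τ̃` takes no unit values, so the preimage is just `ker τ̃ = 0`. -/
theorem FrobeniusForm.isSemisimpleRing_of_preimage_ne (β : FrobeniusForm k A)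
    (hτ : Function.Injective β.higmanTraceTilde)
    (h : β.higmanTraceTilde ⁻¹' ({a | IsUnit a} ∪ {0}) ≠ {0}) : IsSemisimpleRing A := by
  by_contra hA
  refine h (Set.Subset.antisymm (fun t ht => ?_) ?_)
  · obtain ⟨a, rfl⟩ := can_surjective t
    rcases ht with ht | ht
    · exact absurd (β.isSemisimpleRing_of_isUnit ht) hA
    · exact hτ (ht.trans (map_zero _).symm)
  · rintro _ rfl
    exact Or.inr (map_zero _)

end Semisimple

end FrobeniusCartan

open FrobeniusCartan in
theorem theorem2p6 {k A : Type*} [Field k] [Ring A] [Algebra k A] [Module.Finite k A]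
    (hk : IsSplittingFieldFor k A) (β : FrobeniusForm k A) :
    Module.finrank k (LinearMap.range ((cartanMap A).baseChange k)) =
      Module.finrank k (LinearMap.range β.higmanTrace) ∧
    (Nontrivial A →
      List.TFAE [
        IsSemisimpleRing A,
        cartanMatrix k A = 1 ∧ β.higmanTraceTilde ⁻¹' ({a | IsUnit a} ∪ {0}) ≠ {0},
        ¬ (ringChar k : ℤ) ∣ cartanDet k A ∧
          β.higmanTraceTilde ⁻¹' ({a | IsUnit a} ∪ {0}) ≠ {0}]) := by
  have : IsArtinianRing A := IsArtinianRing.of_finite k A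
  let _ := @Fintype.ofFinite (Irr A) (finite_irr k A)
  refine ⟨β.finrank_range_cartanMap hk, fun _ => ?_⟩
  tfae_have 1 → 2 := fun _ => ⟨cartanMatrix_eq_one, β.preimage_higmanTraceTilde_ne hk⟩
  tfae_have 2 → 3 := by
    rintro ⟨h, h'⟩
    refine ⟨fun hd => ?_, h'⟩
    -- Divisibility by `ringChar k` means vanishing in `k`; in characteristic zero `0 ∣ det C` says
    -- `det C = 0`.
    rw [← CharP.intCast_eq_zero_iff k (ringChar k), cartanDet, h, Matrix.det_one,
      Int.cast_one] at hd
    exact one_ne_zero hd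
  tfae_have 3 → 1 := by
    rintro ⟨h, h'⟩
    rw [← CharP.intCast_eq_zero_iff k (ringChar k)] at h
    exact β.isSemisimpleRing_of_preimage_ne (β.higmanTraceTilde_injective hk h) h'
  tfae_finish
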